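/- Let $\mathbb D=\{z\in\mathbb C:|z|<1\}$ and let $v\colon[0,1)\to(0,\infty)$ be a weight, that is, a continuous, non-increasing function, with $\lim_{r\to1^-}v(r)=0$; put $v(z):=v(|z|)$ for $z\in\mathbb D$. Let $$H_v^\infty=\Big\{f\colon\mathbb D\to\mathbb C\text{ holomorphic}:\ \|f\|_{\infty,v}:=\sup_{z\in\mathbb D}|f(z)|v(z)<\infty\Big\},\qquad H_v^0=\Big\{f\colon\mathbb D\to\mathbb C\text{ holomorphic}:\ \lim_{|z|\to1^-}|f(z)|v(z)=0\Big\},$$ both with the norm $\|\cdot\|_{\infty,v}$. For $t\in[0,1)$ let $C_t$ be the generalized Cesàro operator, $C_tf(0)=f(0)$ and $$C_tf(z)=\frac1z\int_0^z\frac{f(\xi)}{1-t\xi}\,d\xi\qquad(z\in\mathbb D\setminus\{0\}),$$ which is a continuous linear operator from $H_v^\infty$ into itself and from $H_v^0$ into itself. For a continuous linear operator $T$ on a normed space $X$, let $\sigma_{pt}(T;X)$ be the set of all $\lambda\in\mathbb C$ such that $\lambda I-T$ is not injective, and let $\sigma(T;X)$ be the set of all $\lambda\in\mathbb C$ such that $\lambda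 I-T$ has no continuous linear inverse on $X$. Then, for every $t\in[0,1)$, $$\sigma_{pt}(C_t;H_v^\infty)=\sigma_{pt}(C_t;H_v^0)=\Big\{\frac1{m+1}:m\in\mathbb N_0\Big\}$$ and $$\sigma(C_t;H_v^\infty)=\sigma(C_t;H_v^0)=\Big\{\frac1{m+1}:m\in\mathbb N_0\Big\}\cup\{0\},$$ where $\mathbb N_0=\{0,1,2,\dots\}$. -/

import Mathlib

open Filter Topology

noncomputable section

namespace WeightedCesaro

/-- The open unit disc of the complex plane. -/
abbrev Disc : Type := Metric.ball (0 : ℂ) 1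

/-- The extension by zero to `ℂ` of a function on the disc. -/
def extendZero (f : Disc → ℂ) (z : ℂ) : ℂ :=
  open Classical in if h : z ∈ Metric.ball (0 : ℂ) 1 then f ⟨z, h⟩ else 0

/-- A function on the disc is holomorphic if it is complex differentiable at every point
(the extension by zero has no influence, since the disc is open). -/
def IsHolomorphic (f : Disc → ℂ) : Prop :=
  DifferentiableOn ℂ (extendZero f) (Metric.ball 0 1)

/-- A weight on `[0,1)`: a continuous, non-increasing, strictly positive function. The values of
the underlying function outside `[0,1)` are irrelevant. -/
structure Weight where
  /-- the underlying function -/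
  toFun : ℝ → ℝ
  continuousOn : ContinuousOn toFun (Set.Ico 0 1)
  antitoneOn : AntitoneOn toFun (Set.Ico 0 1)
  pos : ∀ r ∈ Set.Ico (0 : ℝ) 1, 0 < toFun r

/-- The radial extension `v(z) = v(|z|)` of a weight to the disc. -/
def Weight.onDisc (v : Weight) (z : Disc) : ℝ := v.toFun ‖(z : ℂ)‖

lemma norm_mem_Ico (z : Disc) : ‖(z : ℂ)‖ ∈ Set.Ico (0 : ℝ) 1 :=
  ⟨norm_nonneg _, mem_ball_zero_iff.1 z.2⟩

lemma Weight.onDisc_pos (v : Weight) (z : Disc) : 0 < v.onDisc z := v.pos _ (norm_mem_Ico z)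

lemma extendZero_coe (f : Disc → ℂ) (z : Disc) : extendZero f z = f z := by
  have : (z : ℂ) ∈ Metric.ball (0 : ℂ) 1 := z.2
  simp [extendZero]

lemma extendZero_of_mem (f : Disc → ℂ) {z : ℂ} (h : z ∈ Metric.ball (0 : ℂ) 1) :
    extendZero f z = f ⟨z, h⟩ := extendZero_coe f ⟨z, h⟩

lemma extendZero_add (f g : Disc → ℂ) : extendZero (f + g) = extendZero f + extendZero g := by
  funext z
  by_cases h : z ∈ Metric.ball (0 : ℂ) 1
  · simp only [Pi.add_apply, extendZero_of_mem _ h]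
  · simp only [extendZero, Pi.add_apply, dif_neg h, add_zero]

lemma extendZero_smul (c : ℂ) (f : Disc → ℂ) : extendZero (c • f) = c • extendZero f := by
  funext z
  by_cases h : z ∈ Metric.ball (0 : ℂ) 1
  · simp only [Pi.smul_apply, extendZero_of_mem _ h]
  · simp only [extendZero, Pi.smul_apply, dif_neg h, smul_zero]

/-! ### The spaces -/

/-- The vector space of the holomorphic functions `f` on the disc for which `|f| v` is bounded. -/
def HvInfSubmodule (v : Weight) : Submodule ℂ (Disc → ℂ) where
  carrier := {f | IsHolomorphic f ∧ BddAbove (Set.range fun z => ‖f z‖ * v.onDisc z)}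
  zero_mem' := by
    refine ⟨?_, ⟨0, ?_⟩⟩
    · have : extendZero 0 = fun _ => 0 := by
        funext z
        simp [extendZero]
      unfold IsHolomorphic
      rw [this]
      exact differentiableOn_const _
    · rintro _ ⟨z, rfl⟩
      simp
  add_mem' := by
    rintro f g ⟨hf, A, hA⟩ ⟨hg, B, hB⟩
    refine ⟨?_, A + B, ?_⟩
    · unfold IsHolomorphic
      rw [extendZero_add]
      exact DifferentiableOn.add hf hg
    · rintro _ ⟨z, rfl⟩
      have h1 := hA ⟨z, rfl⟩
      have h2 := hB ⟨z, rfl⟩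
      have h3 := mul_le_mul_of_nonneg_right (norm_add_le (f z) (g z)) (v.onDisc_pos z).le
      simp only [Pi.add_apply] at *
      linarith
  smul_mem' := by
    rintro c f ⟨hf, A, hA⟩
    refine ⟨?_, ‖c‖ * A, ?_⟩
    · unfold IsHolomorphic
      rw [extendZero_smul]
      exact DifferentiableOn.const_smul hf c
    · rintro _ ⟨z, rfl⟩
      have h1 := mul_le_mul_of_nonneg_left (hA ⟨z, rfl⟩) (norm_nonneg c)
      simp only [Pi.smul_apply, norm_smul] at *
      linarith

/-- The space `H_v^∞`. It is a type of its own, so that it carries the topology of its weighted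
sup-norm and not that of pointwise convergence. -/
def HvInf (v : Weight) : Type := HvInfSubmodule v

instance (v : Weight) : AddCommGroup (HvInf v) :=
  inferInstanceAs (AddCommGroup (HvInfSubmodule v))

instance (v : Weight) : Module ℂ (HvInf v) :=
  inferInstanceAs (Module ℂ (HvInfSubmodule v))

instance (v : Weight) : CoeFun (HvInf v) (fun _ => Disc → ℂ) := ⟨fun f => f.1⟩

variable {v : Weight}

lemma HvInf.add_apply (f g : HvInf v) (z : Disc) : (f + g) z = f z + g z := rfl

lemma HvInf.smul_apply (c : ℂ) (f : HvInf v) (z : Disc) : (c • f) z = c * f z := rfl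

lemma HvInf.neg_apply (f : HvInf v) (z : Disc) : (-f) z = -f z := rfl

lemma HvInf.zero_apply (z : Disc) : (0 : HvInf v) z = 0 := rfl

lemma HvInf.ext {f g : HvInf v} (h : ∀ z, f z = g z) : f = g := Subtype.ext (funext h)

lemma HvInf.holomorphic (f : HvInf v) : IsHolomorphic f := f.2.1

/-- The weighted sup-norm `sup_z |f(z)| v(z)`. -/
def weightedNorm (f : HvInf v) : ℝ := ⨆ z : Disc, ‖f z‖ * v.onDisc z

instance : Nonempty Disc := ⟨⟨0, by simp⟩⟩

lemma le_weightedNorm (f : HvInf v) (z : Disc) : ‖f z‖ * v.onDisc z ≤ weightedNorm f :=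
  le_ciSup f.2.2 z

lemma weightedNorm_le {f : HvInf v} {A : ℝ} (h : ∀ z, ‖f z‖ * v.onDisc z ≤ A) :
    weightedNorm f ≤ A := ciSup_le h

lemma weightedNorm_nonneg (f : HvInf v) : 0 ≤ weightedNorm f :=
  Real.iSup_nonneg fun z => mul_nonneg (norm_nonneg _) (v.onDisc_pos z).le

instance : NormedAddCommGroup (HvInf v) :=
  AddGroupNorm.toNormedAddCommGroup
    { toFun := weightedNorm
      map_zero' := by simp [weightedNorm, HvInf.zero_apply]
      add_le' := fun f g => weightedNorm_le fun z => by
        have h1 := le_weightedNorm f z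
        have h2 := le_weightedNorm g z
        have h3 := mul_le_mul_of_nonneg_right (norm_add_le (f z) (g z)) (v.onDisc_pos z).le
        rw [HvInf.add_apply]
        linarith
      neg' := fun f => by simp [weightedNorm, HvInf.neg_apply]
      eq_zero_of_map_eq_zero' := fun f hf => HvInf.ext fun z => by
        have h1 := le_weightedNorm f z
        rw [hf] at h1
        have h2 : ‖f z‖ ≤ 0 := nonpos_of_mul_nonpos_left h1 (v.onDisc_pos z)
        simpa [HvInf.zero_apply] using h2 }

lemma HvInf.norm_def (f : HvInf v) : ‖f‖ = ⨆ z : Disc, ‖f z‖ * v.onDisc z := rfl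

instance : NormedSpace ℂ (HvInf v) where
  norm_smul_le c f := weightedNorm_le fun z => by
    have h1 := mul_le_mul_of_nonneg_left (le_weightedNorm f z) (norm_nonneg c)
    rw [HvInf.smul_apply, norm_mul, mul_assoc]
    exact h1

/-- The filter on the disc that expresses `|z| → 1⁻`. -/
def toBoundary : Filter Disc := comap (fun z : Disc => ‖(z : ℂ)‖) (𝓝[<] 1)

lemma eventually_toBoundary {p : Disc → Prop} :
    (∀ᶠ z in toBoundary, p z) ↔ ∃ ρ ∈ Set.Ico (0 : ℝ) 1, ∀ z : Disc, ρ < ‖(z : ℂ)‖ → p z := by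
  rw [toBoundary, eventually_comap]
  constructor
  · intro h
    obtain ⟨l, hl, hl'⟩ := (mem_nhdsLT_iff_exists_mem_Ico_Ioo_subset zero_lt_one).1 h
    exact ⟨l, hl, fun z hz => hl' ⟨hz, (norm_mem_Ico z).2⟩ z rfl⟩
  · rintro ⟨ρ, hρ, h⟩
    filter_upwards [Ioo_mem_nhdsLT hρ.2] with r hr z hz
    exact h z (hz ▸ hr.1)

/-- The subspace `H_v^0` of `H_v^∞`, with the same norm, of the functions with
`|f(z)| v(z) → 0` as `|z| → 1⁻`. -/
def Hv0 (v : Weight) : Submodule ℂ (HvInf v) where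
  carrier := {f | Tendsto (fun z => ‖f z‖ * v.onDisc z) toBoundary (𝓝 0)}
  zero_mem' := by
    simp only [Set.mem_ofPred_eq, HvInf.zero_apply, norm_zero, zero_mul]
    exact tendsto_const_nhds
  add_mem' := by
    intro f g hf hg
    have := Tendsto.add hf hg
    rw [add_zero] at this
    refine squeeze_zero (fun z => mul_nonneg (norm_nonneg _) (v.onDisc_pos z).le)
      (fun z => ?_) this
    rw [HvInf.add_apply, ← add_mul]
    exact mul_le_mul_of_nonneg_right (norm_add_le _ _) (v.onDisc_pos z).le
  smul_mem' := by
    intro c f hf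
    have := Tendsto.const_mul ‖c‖ hf
    rw [mul_zero] at this
    refine this.congr fun z => ?_
    rw [HvInf.smul_apply, norm_mul, mul_assoc]

/-- A holomorphic function is bounded on each smaller closed disc. -/
lemma IsHolomorphic.bound {f : Disc → ℂ} (hf : IsHolomorphic f) {ρ : ℝ} (hρ : ρ < 1) :
    ∃ M, 0 ≤ M ∧ ∀ z : Disc, ‖(z : ℂ)‖ ≤ ρ → ‖f z‖ ≤ M := by
  have hc : ContinuousOn (extendZero f) (Metric.closedBall 0 ρ) :=
    (DifferentiableOn.continuousOn hf).mono (Metric.closedBall_subset_ball hρ)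
  obtain ⟨M, hM⟩ := (isCompact_closedBall (0 : ℂ) ρ).exists_bound_of_continuousOn hc
  refine ⟨max M 0, le_max_right _ _, fun z hz => ?_⟩
  have := hM z (by simpa using hz)
  rw [extendZero_coe] at this
  exact this.trans (le_max_left _ _)

lemma Weight.onDisc_le_zero (v : Weight) (z : Disc) : v.onDisc z ≤ v.toFun 0 :=
  v.antitoneOn ⟨le_rfl, zero_lt_one⟩ (norm_mem_Ico z) (norm_nonneg _)

/-- Every holomorphic function with `|f(z)| v(z) → 0` as `|z| → 1⁻` lies in `H_v^∞`, so that the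
subspace above consists of all such functions. -/
lemma mem_HvInfSubmodule_of_tendsto {f : Disc → ℂ} (hf : IsHolomorphic f)
    (h0 : Tendsto (fun z => ‖f z‖ * v.onDisc z) toBoundary (𝓝 0)) : f ∈ HvInfSubmodule v := by
  obtain ⟨ρ, hρ, h⟩ := eventually_toBoundary.1 (h0.eventually (gt_mem_nhds zero_lt_one))
  obtain ⟨M, hM0, hM⟩ := hf.bound hρ.2
  refine ⟨hf, max 1 (M * v.toFun 0), ?_⟩
  rintro _ ⟨z, rfl⟩
  by_cases hz : ρ < ‖(z : ℂ)‖
  · exact (h z hz).le.trans (le_max_left _ _)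
  · exact (mul_le_mul (hM z (not_lt.1 hz)) (v.onDisc_le_zero z) (v.onDisc_pos z).le hM0).trans
      (le_max_right _ _)

/-! ### The operator -/

/-- The complex line integral `∫_0^z g(ξ) dξ` along the straight segment `ξ = s z`, `0 ≤ s ≤ 1`. -/
def segmentIntegral (g : ℂ → ℂ) (z : ℂ) : ℂ := ∫ s in (0 : ℝ)..1, g (s * z) * z

/-- The generalized Cesàro transform of a function on the disc: `C_t f(0) = f(0)` and
`C_t f(z) = (1/z) ∫_0^z f(ξ) / (1 - t ξ) dξ` for `z ≠ 0`. -/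
def cesaroFun (t : ℝ) (f : Disc → ℂ) (z : Disc) : ℂ :=
  open Classical in
  if (z : ℂ) = 0 then f z
  else 1 / (z : ℂ) * segmentIntegral (fun ξ => extendZero f ξ / (1 - t * ξ)) z

lemma smul_mem_disc {s : ℝ} (hs : s ∈ Set.Icc (0 : ℝ) 1) {z : ℂ} (hz : z ∈ Metric.ball (0 : ℂ) 1) :
    (s : ℂ) * z ∈ Metric.ball (0 : ℂ) 1 := by
  simp only [Metric.mem_ball, dist_zero_right, norm_mul, Complex.norm_real, Real.norm_eq_abs,
    abs_of_nonneg hs.1] at *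
  nlinarith [hs.2, norm_nonneg z]

lemma one_sub_le_norm {t : ℝ} (ht : t ∈ Set.Ico (0 : ℝ) 1) {z : ℂ}
    (hz : z ∈ Metric.ball (0 : ℂ) 1) : 1 - t ≤ ‖1 - t * z‖ := by
  have h1 := norm_sub_norm_le (1 : ℂ) (t * z)
  simp only [Metric.mem_ball, dist_zero_right, norm_mul, Complex.norm_real, Real.norm_eq_abs,
    abs_of_nonneg ht.1, norm_one] at *
  nlinarith [ht.1, norm_nonneg z]

lemma one_sub_ne_zero {t : ℝ} (ht : t ∈ Set.Ico (0 : ℝ) 1) {z : ℂ}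
    (hz : z ∈ Metric.ball (0 : ℂ) 1) : 1 - (t : ℂ) * z ≠ 0 :=
  norm_pos_iff.1 ((sub_pos.2 ht.2).trans_le (one_sub_le_norm ht hz))

lemma IsHolomorphic.integrand {t : ℝ} (ht : t ∈ Set.Ico (0 : ℝ) 1) {f : Disc → ℂ}
    (hf : IsHolomorphic f) :
    DifferentiableOn ℂ (fun ξ => extendZero f ξ / (1 - t * ξ)) (Metric.ball 0 1) :=
  DifferentiableOn.div hf (by fun_prop) fun _ hz => one_sub_ne_zero ht hz

lemma cesaroFun_eq (t : ℝ) (f : Disc → ℂ) (z : Disc) :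
    cesaroFun t f z = ∫ s in (0 : ℝ)..1, extendZero f (s * z) / (1 - t * (s * z)) := by
  by_cases hz : (z : ℂ) = 0
  · have h0 : extendZero f 0 = f z := by rw [← hz, extendZero_coe]
    simp [cesaroFun, hz, h0]
  · rw [cesaroFun, if_neg hz, segmentIntegral, intervalIntegral.integral_mul_const,
      one_div_mul_eq_div, mul_div_cancel_right₀ _ hz]

lemma intervalIntegrable_integrand {t : ℝ} (ht : t ∈ Set.Ico (0 : ℝ) 1) {f : Disc → ℂ}
    (hf : IsHolomorphic f) (z : Disc) :
    IntervalIntegrable (fun s : ℝ => extendZero f (s * z) / (1 - t * (s * z)))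
      MeasureTheory.volume 0 1 := by
  apply ContinuousOn.intervalIntegrable
  rw [Set.uIcc_of_le zero_le_one]
  exact (hf.integrand ht).continuousOn.comp (f := fun s : ℝ => (s : ℂ) * z) (by fun_prop)
    fun s hs => smul_mem_disc hs z.2

lemma IsHolomorphic.cesaroFun {t : ℝ} (ht : t ∈ Set.Ico (0 : ℝ) 1) {f : Disc → ℂ}
    (hf : IsHolomorphic f) : IsHolomorphic (cesaroFun t f) := by
  obtain ⟨G, hG⟩ := (hf.integrand ht).isExactOn_ball
  have hG' : DifferentiableOn ℂ G (Metric.ball 0 1) := fun z hz =>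
    (hG z hz).differentiableAt.differentiableWithinAt
  have hd := (Complex.differentiableOn_dslope (c := 0)
    (Metric.isOpen_ball.mem_nhds (Metric.mem_ball_self (zero_lt_one (α := ℝ))))).2 hG'
  refine hd.congr fun z hz => ?_
  rw [extendZero_of_mem _ hz]
  by_cases hz0 : z = 0
  · subst hz0
    have h0 := (hG 0 hz).deriv
    simp only [mul_zero, sub_zero, div_one] at h0
    rw [dslope_same, h0, extendZero_of_mem _ hz]
    simp [WeightedCesaro.cesaroFun]
  · rw [dslope_of_ne _ hz0, slope_def_field, WeightedCesaro.cesaroFun, if_neg hz0,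
      segmentIntegral]
    have key := intervalIntegral.integral_eq_sub_of_hasDerivAt (a := 0) (b := 1)
      (f := fun s : ℝ => G (s * z))
      (f' := fun s : ℝ => extendZero f (s * z) / (1 - t * (s * z)) * z) ?_ ?_
    · simp only [Complex.ofReal_one, one_mul, Complex.ofReal_zero, zero_mul] at key
      rw [key]
      simp only [sub_zero]
      field_simp
    · intro s hs
      rw [Set.uIcc_of_le zero_le_one] at hs
      have h1 : HasDerivAt (fun s : ℂ => s * z) z (s : ℂ) := by
        simpa using (hasDerivAt_id (s : ℂ)).mul_const z
      exact ((hG _ (smul_mem_disc hs hz)).comp (s : ℂ) h1).comp_ofReal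
    · exact (intervalIntegrable_integrand ht hf ⟨z, hz⟩).mul_const z

lemma norm_cesaroFun_le {t : ℝ} (ht : t ∈ Set.Ico (0 : ℝ) 1) {f : Disc → ℂ} {z : Disc} {B : ℝ}
    (hB : ∀ w : Disc, ‖(w : ℂ)‖ ≤ ‖(z : ℂ)‖ → ‖f w‖ ≤ B) :
    ‖cesaroFun t f z‖ ≤ B / (1 - t) := by
  rw [cesaroFun_eq]
  have h := intervalIntegral.norm_integral_le_of_norm_le_const (a := 0) (b := 1)
    (f := fun s : ℝ => extendZero f (s * z) / (1 - t * (s * z))) (C := B / (1 - t)) ?_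
  · simpa using h
  · intro s hs
    rw [Set.uIoc_of_le zero_le_one] at hs
    have hs' : s ∈ Set.Icc (0 : ℝ) 1 := ⟨hs.1.le, hs.2⟩
    have hm := smul_mem_disc hs' z.2
    have hn : ‖(s : ℂ) * z‖ ≤ ‖(z : ℂ)‖ := by
      rw [norm_mul, Complex.norm_real, Real.norm_eq_abs, abs_of_nonneg hs'.1]
      exact mul_le_of_le_one_left (norm_nonneg _) hs'.2
    have h1 := hB ⟨_, hm⟩ hn
    rw [extendZero_of_mem _ hm, norm_div]
    exact div_le_div₀ ((norm_nonneg _).trans h1) h1 (sub_pos.2 ht.2) (one_sub_le_norm ht hm)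

lemma cesaroFun_weighted_le {t : ℝ} (ht : t ∈ Set.Ico (0 : ℝ) 1) (f : HvInf v) (z : Disc) :
    ‖cesaroFun t f z‖ * v.onDisc z ≤ 1 / (1 - t) * ‖f‖ := by
  have hv := v.onDisc_pos z
  have h : ‖cesaroFun t f z‖ ≤ ‖f‖ / v.onDisc z / (1 - t) := by
    refine norm_cesaroFun_le ht fun w hw => ?_
    rw [le_div_iff₀ hv]
    refine le_trans ?_ (le_weightedNorm f w)
    exact mul_le_mul_of_nonneg_left
      (v.antitoneOn (norm_mem_Ico w) (norm_mem_Ico z) hw) (norm_nonneg _)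
  calc ‖cesaroFun t f z‖ * v.onDisc z ≤ ‖f‖ / v.onDisc z / (1 - t) * v.onDisc z :=
        mul_le_mul_of_nonneg_right h hv.le
    _ = 1 / (1 - t) * ‖f‖ := by field_simp

/-- The generalized Cesàro operator `C_t` as a continuous linear operator on `H_v^∞`. -/
def cesaro (v : Weight) (t : ℝ) (ht : t ∈ Set.Ico (0 : ℝ) 1) : HvInf v →L[ℂ] HvInf v :=
  LinearMap.mkContinuous
    { toFun := fun f => ⟨cesaroFun t f, f.holomorphic.cesaroFun ht, 1 / (1 - t) * ‖f‖, by
        rintro _ ⟨z, rfl⟩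
        exact cesaroFun_weighted_le ht f z⟩
      map_add' := fun f g => HvInf.ext fun z => by
        change cesaroFun t (f.1 + g.1) z = cesaroFun t f.1 z + cesaroFun t g.1 z
        rw [cesaroFun_eq, cesaroFun_eq, cesaroFun_eq, extendZero_add,
          ← intervalIntegral.integral_add (intervalIntegrable_integrand ht f.holomorphic z)
            (intervalIntegrable_integrand ht g.holomorphic z)]
        simp only [Pi.add_apply, add_div]
      map_smul' := fun c f => HvInf.ext fun z => by
        change cesaroFun t (c • f.1) z = c * cesaroFun t f.1 z
        rw [cesaroFun_eq, cesaroFun_eq, extendZero_smul,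
          ← intervalIntegral.integral_const_mul]
        simp only [Pi.smul_apply, smul_eq_mul, mul_div_assoc] }
    (1 / (1 - t)) fun f => weightedNorm_le (cesaroFun_weighted_le ht f)

lemma cesaro_apply (v : Weight) (t : ℝ) (ht : t ∈ Set.Ico (0 : ℝ) 1) (f : HvInf v) (z : Disc) :
    cesaro v t ht f z = cesaroFun t f z := rfl

/-- The condition `v(r) → 0` as `r → 1⁻`. -/
def Weight.VanishesAtOne (v : Weight) : Prop := Tendsto v.toFun (𝓝[<] 1) (𝓝 0)

lemma cesaro_mem_Hv0 (hv : v.VanishesAtOne) (t : ℝ) (ht : t ∈ Set.Ico (0 : ℝ) 1) {f : HvInf v}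
    (hf : f ∈ Hv0 v) : cesaro v t ht f ∈ Hv0 v := by
  have hv' : Tendsto v.onDisc toBoundary (𝓝 0) := Tendsto.comp hv tendsto_comap
  have h1t : 0 < 1 - t := sub_pos.2 ht.2
  change Tendsto _ _ _
  refine Metric.tendsto_nhds.2 fun ε hε => ?_
  have hδ : 0 < ε * (1 - t) / 2 := by positivity
  obtain ⟨ρ, hρ, hρ'⟩ := eventually_toBoundary.1 (Tendsto.eventually hf (gt_mem_nhds hδ))
  obtain ⟨M, hM0, hM⟩ := f.holomorphic.bound hρ.2
  have hlim : Tendsto (fun z => M * v.onDisc z) toBoundary (𝓝 0) := by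
    simpa using hv'.const_mul M
  filter_upwards [hlim.eventually (gt_mem_nhds hδ)] with z hz
  have hvz := v.onDisc_pos z
  have h : ‖cesaroFun t f z‖ ≤ ε * (1 - t) / 2 / v.onDisc z / (1 - t) := by
    refine norm_cesaroFun_le ht fun w hw => ?_
    rw [le_div_iff₀ hvz]
    by_cases hw' : ρ < ‖(w : ℂ)‖
    · refine le_trans ?_ (hρ' w hw').le
      exact mul_le_mul_of_nonneg_left
        (v.antitoneOn (norm_mem_Ico w) (norm_mem_Ico z) hw) (norm_nonneg _)
    · exact (mul_le_mul_of_nonneg_right (hM w (not_lt.1 hw')) hvz.le).trans hz.le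
  have h2 : ‖cesaroFun t f z‖ * v.onDisc z ≤ ε / 2 := by
    calc ‖cesaroFun t f z‖ * v.onDisc z
        ≤ ε * (1 - t) / 2 / v.onDisc z / (1 - t) * v.onDisc z :=
          mul_le_mul_of_nonneg_right h hvz.le
      _ = ε / 2 := by field_simp
  rw [cesaro_apply, dist_zero_right, Real.norm_of_nonneg (mul_nonneg (norm_nonneg _) hvz.le)]
  linarith

/-- The generalized Cesàro operator `C_t` as a continuous linear operator on `H_v^0`, for a weight
`v` with `v(r) → 0` as `r → 1⁻`: the restriction of `C_t` on `H_v^∞`. -/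
def cesaro0 (v : Weight) (hv : v.VanishesAtOne) (t : ℝ) (ht : t ∈ Set.Ico (0 : ℝ) 1) :
    Hv0 v →L[ℂ] Hv0 v :=
  ((cesaro v t ht).comp (Hv0 v).subtypeL).codRestrict (Hv0 v)
    fun f => cesaro_mem_Hv0 hv t ht f.2

/-- The point spectrum of a continuous linear operator: the set of its eigenvalues, that is, of the
complex `μ` for which `T - μ I` is not injective. -/
def pointSpectrum {X : Type*} [NormedAddCommGroup X] [NormedSpace ℂ X] (T : X →L[ℂ] X) : Set ℂ :=
  {μ | Module.End.HasEigenvalue (T : X →ₗ[ℂ] X) μ}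

end WeightedCesaro

end

/-! Substituting `ξ = s z` turns `C_t` into the case `n = 0` of the family `T_n f(z) = ∫_0^1 s^n
f(sz) / (1 - tsz) ds`. On `H_v^∞` this family has three properties: `‖T_n‖ ≤ 1/((n+1)(1-t))`
(`norm_moment_le`), `T_n f(0) = f(0)/(n+1)` (`moment_origin`), and `T_n(z g) = z T_{n+1} g`
(`moment_mulCoord`). Since every `f` is uniquely `f(0) + z g` with `g` in the same space, `μ - T_n`
is triangular, with diagonal entries `μ - 1/(n+1)` and `μ - T_{n+1}`. For `μ ≠ 0` the operator `μ -
T_n` is invertible for large `n` by a Neumann series. If `μ` is none of the `1/(m+1)`, invertibility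
descends to `n = 0` (`bijective_sub_moment_of_succ`, `bijective_sub_moment`). No compactness
argument is needed.

Conversely, with `μ = 1/(m+1)` the equation `μ (z f)' = f/(1 - tz)` integrates to the bounded
eigenfunction `z^m / (1 - tz)^(m+1)` (`cesaro_eigenfunction`). The number `0` is not an eigenvalue,
because a vanishing integral can be differentiated (`cesaro_injective`). It lies in the spectrum
because the spectrum is closed and `1/(m+1) → 0`.

Everything passes to `H_v^0` because `C_t` maps all of `H_v^∞` into it (`cesaro_apply_mem_Hv0`): if
`μ ≠ 0` and `μ f - C_t f` is in `H_v^0`, then so is `f`. -/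

namespace WeightedCesaro

/-! ### Differentiation under the integral sign. -/

/-- The moments `∫_0^1 s^n K(sz) ds` of a holomorphic function are holomorphic. -/
lemma differentiableOn_moment {K : ℂ → ℂ} (hK : DifferentiableOn ℂ K (Metric.ball 0 1)) (n : ℕ) :
    DifferentiableOn ℂ (fun z => ∫ s in (0 : ℝ)..1, (s : ℂ) ^ n * K (s * z))
      (Metric.ball 0 1) := by
  intro z₀ hz₀
  have hz₀' : ‖z₀‖ < 1 := mem_ball_zero_iff.1 hz₀
  -- An intermediate radius: `deriv K` is bounded on the compact disc of radius `r`, which gives a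
  -- constant dominating function.
  obtain ⟨r, hr0, hr1⟩ := exists_between hz₀'
  have hK' : ContinuousOn (deriv K) (Metric.ball 0 1) := (hK.deriv Metric.isOpen_ball).continuousOn
  obtain ⟨M, hM⟩ := (isCompact_closedBall (0 : ℂ) r).exists_bound_of_continuousOn
    (hK'.mono (Metric.closedBall_subset_ball hr1))
  have hball : Metric.ball (0 : ℂ) r ∈ 𝓝 z₀ :=
    Metric.isOpen_ball.mem_nhds (mem_ball_zero_iff.2 hr0)
  have hsub : Metric.ball (0 : ℂ) r ⊆ Metric.ball 0 1 := Metric.ball_subset_ball hr1.le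
  have hcont : ∀ (k : ℕ) (L : ℂ → ℂ), ContinuousOn L (Metric.ball 0 1) →
      ∀ z ∈ Metric.ball (0 : ℂ) 1,
        ContinuousOn (fun s : ℝ => (s : ℂ) ^ k * L (s * z)) (Set.uIcc 0 1) := by
    intro k L hL z hz
    rw [Set.uIcc_of_le zero_le_one]
    refine ContinuousOn.mul (by fun_prop) ?_
    exact hL.comp (f := fun s : ℝ => (s : ℂ) * z) (by fun_prop) fun s hs => smul_mem_disc hs hz
  have hmeas : ∀ (k : ℕ) (L : ℂ → ℂ), ContinuousOn L (Metric.ball 0 1) →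
      ∀ z ∈ Metric.ball (0 : ℂ) 1,
        MeasureTheory.AEStronglyMeasurable (fun s : ℝ => (s : ℂ) ^ k * L (s * z))
          (MeasureTheory.volume.restrict (Set.uIoc 0 1)) := fun k L hL z hz =>
    ((hcont k L hL z hz).mono Set.uIoc_subset_uIcc).aestronglyMeasurable measurableSet_uIoc
  have key := intervalIntegral.hasDerivAt_integral_of_dominated_loc_of_deriv_le
    (𝕜 := ℂ) (μ := MeasureTheory.volume) (a := 0) (b := 1) (x₀ := z₀) (s := Metric.ball 0 r)
    (F := fun z s => (s : ℂ) ^ n * K (s * z))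
    (F' := fun z s => (s : ℂ) ^ (n + 1) * deriv K (s * z)) (bound := fun _ => M) hball
    (by filter_upwards [hball] with z hz using hmeas n K hK.continuousOn z (hsub hz))
    (hcont n K hK.continuousOn z₀ hz₀).intervalIntegrable
    (hmeas (n + 1) _ hK' z₀ hz₀) ?_ intervalIntegrable_const ?_
  · exact key.2.differentiableAt.differentiableWithinAt
  · refine Eventually.of_forall fun s hs z hz => ?_
    rw [Set.uIoc_of_le zero_le_one] at hs
    have hz' : ‖z‖ < r := mem_ball_zero_iff.1 hz
    have hs1 : ‖(s : ℂ)‖ ≤ 1 := by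
      rw [Complex.norm_real, Real.norm_of_nonneg hs.1.le]; exact hs.2
    have hM' : ‖deriv K (s * z)‖ ≤ M := hM _ <| mem_closedBall_zero_iff.2 <| by
      rw [norm_mul]
      exact (mul_le_of_le_one_left (norm_nonneg _) hs1).trans hz'.le
    rw [norm_mul, norm_pow]
    exact (mul_le_of_le_one_left (norm_nonneg _) (pow_le_one₀ (norm_nonneg _) hs1)).trans hM'
  · refine Eventually.of_forall fun s hs z hz => ?_
    rw [Set.uIoc_of_le zero_le_one] at hs
    have hm := smul_mem_disc ⟨hs.1.le, hs.2⟩ (hsub hz)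
    have h1 : HasDerivAt (fun w : ℂ => (s : ℂ) * w) (s : ℂ) z := by
      simpa using (hasDerivAt_id z).const_mul (s : ℂ)
    have h2 := ((hK.differentiableAt (Metric.isOpen_ball.mem_nhds hm)).hasDerivAt.comp z h1
      ).const_mul ((s : ℂ) ^ n)
    exact h2.congr_deriv (by rw [pow_succ]; ring)

/-! ### Completeness -/

variable {v : Weight}

lemma isHolomorphic_of_differentiableOn {g : ℂ → ℂ} (hg : DifferentiableOn ℂ g (Metric.ball 0 1)) :
    IsHolomorphic fun z : Disc => g z :=
  hg.congr fun _ hz => extendZero_of_mem _ hz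

lemma HvInf.norm_apply_le (f : HvInf v) (z : Disc) : ‖f z‖ ≤ ‖f‖ / v.onDisc z :=
  (le_div_iff₀ (v.onDisc_pos z)).2 (le_weightedNorm f z)

lemma HvInf.sub_apply (f g : HvInf v) (z : Disc) : (f - g) z = f z - g z := rfl

lemma HvInf.norm_sub_apply_le (f g : HvInf v) (z : Disc) :
    ‖f z - g z‖ * v.onDisc z ≤ dist f g := by
  rw [dist_eq_norm, ← HvInf.sub_apply]
  exact le_weightedNorm (f - g) z

/-- A bound in the weighted norm is a uniform bound on each compact subset of the disc, where `v` is
bounded away from zero. The pointwise limit of a Cauchy sequence is therefore holomorphic by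
Weierstrass. Completeness is needed for the Neumann series and for inverting bijections
continuously. -/
instance : CompleteSpace (HvInf v) := by
  refine Metric.complete_of_cauchySeq_tendsto fun u hu => ?_
  have hpt : ∀ z : Disc, CauchySeq fun n => u n z := by
    intro z
    refine Metric.cauchySeq_iff.2 fun ε hε => ?_
    have hv := v.onDisc_pos z
    obtain ⟨N, hN⟩ := Metric.cauchySeq_iff.1 hu (ε * v.onDisc z) (by positivity)
    refine ⟨N, fun m hm n hn => ?_⟩
    have h1 := (HvInf.norm_sub_apply_le (u m) (u n) z).trans_lt (hN m hm n hn)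
    rw [dist_eq_norm]
    exact lt_of_mul_lt_mul_right h1 hv.le
  choose f hf using fun z => cauchySeq_tendsto_of_complete (hpt z)
  have hunif : ∀ ε > 0, ∃ N, ∀ n ≥ N, ∀ z : Disc, ‖u n z - f z‖ * v.onDisc z ≤ ε := by
    intro ε hε
    obtain ⟨N, hN⟩ := Metric.cauchySeq_iff.1 hu ε hε
    refine ⟨N, fun n hn z => ?_⟩
    have hlim : Tendsto (fun m => ‖u n z - u m z‖ * v.onDisc z) atTop
        (𝓝 (‖u n z - f z‖ * v.onDisc z)) := ((tendsto_const_nhds.sub (hf z)).norm).mul_const _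
    -- Letting `m → ∞` at a fixed point keeps `N` independent of the point.
    refine le_of_tendsto hlim (eventually_atTop.2 ⟨N, fun m hm => ?_⟩)
    exact (HvInf.norm_sub_apply_le (u n) (u m) z).trans (hN n hn m hm).le
  have hhol : IsHolomorphic f := by
    refine TendstoLocallyUniformlyOn.differentiableOn (φ := atTop)
      (F := fun n => extendZero (u n)) ?_ (Eventually.of_forall fun n => (u n).holomorphic)
      Metric.isOpen_ball
    refine (tendstoLocallyUniformlyOn_iff_forall_isCompact Metric.isOpen_ball).2 fun S hS hSc => ?_
    refine Metric.tendstoUniformlyOn_iff.2 fun ε hε => ?_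
    obtain ⟨r, hr, hr'⟩ : ∃ r ∈ Set.Ico (0 : ℝ) 1, ∀ z ∈ S, ‖z‖ ≤ r := by
      rcases S.eq_empty_or_nonempty with rfl | hne
      · exact ⟨0, ⟨le_rfl, zero_lt_one⟩, by simp⟩
      · obtain ⟨w, hw, hmax⟩ := hSc.exists_isMaxOn hne continuous_norm.continuousOn
        exact ⟨‖w‖, norm_mem_Ico ⟨w, hS hw⟩, fun z hz => hmax hz⟩
    have hvr := v.pos r hr
    obtain ⟨N, hN⟩ := hunif (ε * v.toFun r / 2) (by positivity)
    filter_upwards [eventually_ge_atTop N] with n hn z hz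
    have h1 := hN n hn ⟨z, hS hz⟩
    have h2 : v.toFun r ≤ v.onDisc ⟨z, hS hz⟩ :=
      v.antitoneOn (norm_mem_Ico ⟨z, hS hz⟩) hr (hr' z hz)
    rw [extendZero_of_mem _ (hS hz), extendZero_of_mem _ (hS hz), dist_comm, dist_eq_norm]
    have h3 := (mul_le_mul_of_nonneg_left h2 (norm_nonneg (u n ⟨z, hS hz⟩ - f ⟨z, hS hz⟩))).trans h1
    have h4 : ‖u n ⟨z, hS hz⟩ - f ⟨z, hS hz⟩‖ ≤ ε / 2 := by
      refine le_of_mul_le_mul_right (h3.trans_eq ?_) hvr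
      ring
    linarith
  have hbdd : BddAbove (Set.range fun z => ‖f z‖ * v.onDisc z) := by
    obtain ⟨N, hN⟩ := hunif 1 one_pos
    refine ⟨1 + ‖u N‖, ?_⟩
    rintro _ ⟨z, rfl⟩
    have h1 := hN N le_rfl z
    have h2 : ‖u N z‖ * v.onDisc z ≤ ‖u N‖ := le_weightedNorm (u N) z
    have h3 : ‖f z‖ ≤ ‖u N z - f z‖ + ‖u N z‖ := by
      rw [norm_sub_rev]; simpa using norm_add_le (f z - u N z) (u N z)
    have h4 := mul_le_mul_of_nonneg_right h3 (v.onDisc_pos z).le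
    change ‖f z‖ * v.onDisc z ≤ _
    linarith
  let F : HvInf v := ⟨f, hhol, hbdd⟩
  refine ⟨F, Metric.tendsto_atTop.2 fun ε hε => ?_⟩
  obtain ⟨N, hN⟩ := hunif (ε / 2) (by positivity)
  refine ⟨N, fun n hn => ?_⟩
  have : dist (u n) F ≤ ε / 2 := by
    rw [dist_eq_norm]
    exact weightedNorm_le (hN n hn)
  linarith

lemma isClosed_Hv0 : IsClosed (Hv0 v : Set (HvInf v)) := by
  refine isClosed_of_closure_subset fun f hf => ?_
  refine Metric.tendsto_nhds.2 fun ε hε => ?_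
  obtain ⟨g, hg, hfg⟩ := Metric.mem_closure_iff.1 hf (ε / 2) (by positivity)
  have hg' : Tendsto (fun z => ‖g z‖ * v.onDisc z) toBoundary (𝓝 0) := hg
  filter_upwards [hg'.eventually (gt_mem_nhds (half_pos hε))] with z hz
  have hv := v.onDisc_pos z
  have h1 := HvInf.norm_sub_apply_le f g z
  have h2 : ‖f z‖ ≤ ‖f z - g z‖ + ‖g z‖ := by simpa using norm_add_le (f z - g z) (g z)
  have h3 := mul_le_mul_of_nonneg_right h2 hv.le
  rw [dist_zero_right, Real.norm_of_nonneg (mul_nonneg (norm_nonneg _) hv.le)]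
  linarith

instance : CompleteSpace (Hv0 v) := isClosed_Hv0.completeSpace_coe

/-! ### Multiplication and division by the coordinate -/

/-- The bounded holomorphic functions belong to every `H_v^∞`. -/
lemma mem_HvInfSubmodule_of_bounded {f : Disc → ℂ} (hf : IsHolomorphic f) {M : ℝ}
    (hM : ∀ z, ‖f z‖ ≤ M) : f ∈ HvInfSubmodule v := by
  refine ⟨hf, M * v.toFun 0, ?_⟩
  rintro _ ⟨z, rfl⟩
  exact mul_le_mul (hM z) (v.onDisc_le_zero z) (v.onDisc_pos z).le
    ((norm_nonneg _).trans (hM z))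

/-- The constant functions. -/
def HvInf.const (v : Weight) (a : ℂ) : HvInf v :=
  ⟨fun _ => a, mem_HvInfSubmodule_of_bounded
    (isHolomorphic_of_differentiableOn (differentiableOn_const a)) fun _ => le_rfl⟩

/-- Multiplication by the coordinate. -/
def HvInf.mulCoord (f : HvInf v) : HvInf v :=
  ⟨fun z => z * f z, by
    refine ⟨?_, ‖f‖, ?_⟩
    · refine (DifferentiableOn.mul differentiableOn_id f.holomorphic).congr fun z hz => ?_
      simp [extendZero_of_mem _ hz]
    · rintro _ ⟨z, rfl⟩
      refine le_trans ?_ (le_weightedNorm f z)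
      have := mul_le_of_le_one_left (norm_nonneg (f z)) (norm_mem_Ico z).2.le
      rw [← norm_mul] at this
      exact mul_le_mul_of_nonneg_right this (v.onDisc_pos z).le⟩

lemma HvInf.const_apply (a : ℂ) (z : Disc) : HvInf.const v a z = a := rfl

lemma HvInf.mulCoord_apply (f : HvInf v) (z : Disc) : f.mulCoord z = z * f z := rfl

/-- The centre of the disc. -/
def origin : Disc := ⟨0, by simp⟩

/-- The quotient `f/z` is the difference quotient at `0`, hence holomorphic. Dividing by `z` costs
at most a factor `2` where `|z| > 1/2`, and on `|z| ≤ 1/2` compactness gives the bound. -/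
lemma HvInf.exists_eq_mulCoord (f : HvInf v) (hf : f origin = 0) : ∃ g : HvInf v, f = g.mulCoord := by
  have hd := (Complex.differentiableOn_dslope (c := 0)
    (Metric.isOpen_ball.mem_nhds (Metric.mem_ball_self (zero_lt_one (α := ℝ))))).2 f.holomorphic
  have hg := isHolomorphic_of_differentiableOn hd
  have h0 : extendZero f 0 = 0 := (extendZero_coe f origin).trans hf
  have hmul : ∀ z : Disc, f z = z * dslope (extendZero f) 0 z := by
    intro z
    by_cases hz : (z : ℂ) = 0
    · rw [hz, zero_mul, ← extendZero_coe f z, hz, h0]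
    · rw [dslope_of_ne _ hz, slope_def_field, h0, extendZero_coe]
      simp only [sub_zero]
      field_simp
  obtain ⟨M, hM0, hM⟩ := hg.bound (ρ := 1 / 2) (by norm_num)
  refine ⟨⟨fun z => dslope (extendZero f) 0 z, hg, max (2 * ‖f‖) (M * v.toFun 0), ?_⟩,
    HvInf.ext hmul⟩
  rintro _ ⟨z, rfl⟩
  by_cases hz : ‖(z : ℂ)‖ ≤ 1 / 2
  · exact (mul_le_mul (hM z hz) (v.onDisc_le_zero z) (v.onDisc_pos z).le hM0).trans
      (le_max_right _ _)
  · refine le_trans ?_ (le_max_left _ _)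
    have h1 : ‖f z‖ * v.onDisc z ≤ ‖f‖ := le_weightedNorm f z
    have hv := v.onDisc_pos z
    rw [hmul z, norm_mul] at h1
    have h2 := mul_le_mul_of_nonneg_right (not_le.1 hz).le
      (mul_nonneg (norm_nonneg (dslope (extendZero f) 0 z)) hv.le)
    change ‖dslope (extendZero f) 0 z‖ * v.onDisc z ≤ _
    linarith

/-! ### The moment operators -/

/-- The transform `f ↦ ∫_0^1 s^n f(sz) / (1 - tsz) ds`. -/
noncomputable def momentFun (t : ℝ) (n : ℕ) (f : Disc → ℂ) (z : Disc) : ℂ :=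
  ∫ s in (0 : ℝ)..1, (s : ℂ) ^ n * (extendZero f (s * z) / (1 - t * (s * z)))

lemma momentFun_zero (t : ℝ) (f : Disc → ℂ) (z : Disc) : momentFun t 0 f z = cesaroFun t f z := by
  simp [momentFun, cesaroFun_eq]

lemma intervalIntegrable_moment {t : ℝ} (ht : t ∈ Set.Ico (0 : ℝ) 1) {f : Disc → ℂ}
    (hf : IsHolomorphic f) (n : ℕ) (z : Disc) :
    IntervalIntegrable (fun s : ℝ => (s : ℂ) ^ n * (extendZero f (s * z) / (1 - t * (s * z))))
      MeasureTheory.volume 0 1 :=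
  (intervalIntegrable_integrand ht hf z).continuousOn_mul (by fun_prop)

lemma IsHolomorphic.momentFun {t : ℝ} (ht : t ∈ Set.Ico (0 : ℝ) 1) {f : Disc → ℂ}
    (hf : IsHolomorphic f) (n : ℕ) : IsHolomorphic (momentFun t n f) :=
  isHolomorphic_of_differentiableOn (differentiableOn_moment (hf.integrand ht) n)

/-- As `v` is non-increasing and `|sz| ≤ |z|`, the bound for `f` at `sz` is no worse than the one at
`z`. It is uniform in `s`, so integrating it against `s^n` yields the factor `1/(n+1)`. -/
lemma HvInf.norm_integrand_le {t : ℝ} (ht : t ∈ Set.Ico (0 : ℝ) 1) (f : HvInf v) (z : Disc) {s : ℝ}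
    (hs : s ∈ Set.Icc (0 : ℝ) 1) :
    ‖extendZero f (s * z) / (1 - t * (s * z))‖ ≤ ‖f‖ / v.onDisc z / (1 - t) := by
  have hm := smul_mem_disc hs z.2
  have hn : ‖(s : ℂ) * z‖ ≤ ‖(z : ℂ)‖ := by
    rw [norm_mul, Complex.norm_real, Real.norm_of_nonneg hs.1]
    exact mul_le_of_le_one_left (norm_nonneg _) hs.2
  have hv : v.onDisc z ≤ v.onDisc ⟨_, hm⟩ :=
    v.antitoneOn (norm_mem_Ico ⟨_, hm⟩) (norm_mem_Ico z) hn
  rw [extendZero_of_mem _ hm, norm_div]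
  refine div_le_div₀ (div_nonneg (norm_nonneg _) (v.onDisc_pos z).le) ?_ (sub_pos.2 ht.2)
    (one_sub_le_norm ht hm)
  exact (f.norm_apply_le _).trans
    (div_le_div_of_nonneg_left (norm_nonneg _) (v.onDisc_pos z) hv)

lemma momentFun_weighted_le {t : ℝ} (ht : t ∈ Set.Ico (0 : ℝ) 1) (n : ℕ) (f : HvInf v) (z : Disc) :
    ‖momentFun t n f z‖ * v.onDisc z ≤ 1 / ((n + 1) * (1 - t)) * ‖f‖ := by
  have hv := v.onDisc_pos z
  have h1t : 0 < 1 - t := sub_pos.2 ht.2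
  have h : ‖momentFun t n f z‖ ≤ ∫ s in (0 : ℝ)..1, s ^ n * (‖f‖ / v.onDisc z / (1 - t)) := by
    refine intervalIntegral.norm_integral_le_of_norm_le zero_le_one
      (Eventually.of_forall fun s hs => ?_) (Continuous.intervalIntegrable (by fun_prop) _ _)
    rw [norm_mul, norm_pow, Complex.norm_real, Real.norm_of_nonneg hs.1.le]
    exact mul_le_mul_of_nonneg_left (f.norm_integrand_le ht z ⟨hs.1.le, hs.2⟩)
      (pow_nonneg hs.1.le _)
  rw [intervalIntegral.integral_mul_const, integral_pow] at h
  refine (mul_le_mul_of_nonneg_right h hv.le).trans_eq ?_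
  simp only [one_pow, ne_eq, Nat.succ_ne_zero, not_false_eq_true, zero_pow, sub_zero]
  field_simp

/-- The transform `f ↦ ∫_0^1 s^n f(sz) / (1 - tsz) ds` as a continuous linear operator. -/
noncomputable def moment (v : Weight) (t : ℝ) (ht : t ∈ Set.Ico (0 : ℝ) 1) (n : ℕ) :
    HvInf v →L[ℂ] HvInf v :=
  LinearMap.mkContinuous
    { toFun := fun f => ⟨momentFun t n f, f.holomorphic.momentFun ht n,
        1 / ((n + 1) * (1 - t)) * ‖f‖, by
        rintro _ ⟨z, rfl⟩
        exact momentFun_weighted_le ht n f z⟩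
      map_add' := fun f g => HvInf.ext fun z => by
        change momentFun t n (f.1 + g.1) z = momentFun t n f.1 z + momentFun t n g.1 z
        rw [momentFun, momentFun, momentFun, extendZero_add,
          ← intervalIntegral.integral_add (intervalIntegrable_moment ht f.holomorphic n z)
            (intervalIntegrable_moment ht g.holomorphic n z)]
        simp only [Pi.add_apply, add_div, mul_add]
      map_smul' := fun c f => HvInf.ext fun z => by
        change momentFun t n (c • f.1) z = c * momentFun t n f.1 z
        rw [momentFun, momentFun, extendZero_smul, ← intervalIntegral.integral_const_mul]
        simp only [Pi.smul_apply, smul_eq_mul, mul_div_assoc, mul_left_comm] }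
    (1 / ((n + 1) * (1 - t))) fun f => weightedNorm_le (momentFun_weighted_le ht n f)

variable {t : ℝ} {ht : t ∈ Set.Ico (0 : ℝ) 1}

lemma moment_apply (n : ℕ) (f : HvInf v) (z : Disc) : moment v t ht n f z = momentFun t n f z := rfl

lemma moment_zero : moment v t ht 0 = cesaro v t ht :=
  ContinuousLinearMap.ext fun f => HvInf.ext fun z => momentFun_zero t f z

lemma norm_moment_le (n : ℕ) : ‖moment v t ht n‖ ≤ 1 / ((n + 1) * (1 - t)) :=
  LinearMap.mkContinuous_norm_le _
    (one_div_nonneg.2 (mul_nonneg (by positivity) (sub_pos.2 ht.2).le)) _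

lemma moment_origin (n : ℕ) (f : HvInf v) :
    moment v t ht n f origin = 1 / ((n : ℂ) + 1) * f origin := by
  have h0 : extendZero f 0 = f origin := extendZero_coe f origin
  have h1 : ∫ s in (0 : ℝ)..1, (s : ℂ) ^ n = 1 / ((n : ℂ) + 1) := by
    have := integral_pow (a := 0) (b := 1) n
    simp only [← Complex.ofReal_pow, intervalIntegral.integral_ofReal, this]
    simp
  rw [moment_apply, momentFun]
  simp only [origin, mul_zero, sub_zero, div_one] at h0 ⊢
  rw [h0, intervalIntegral.integral_mul_const, h1]

/-- The coordinate at `sz` is `s z`: the factor `s` raises the moment and `z` leaves the integral.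
This relation links consecutive operators and drives the descent. -/
lemma moment_mulCoord (n : ℕ) (f : HvInf v) :
    moment v t ht n f.mulCoord = (moment v t ht (n + 1) f).mulCoord := by
  refine HvInf.ext fun z => ?_
  rw [HvInf.mulCoord_apply, moment_apply, moment_apply, momentFun, momentFun,
    ← intervalIntegral.integral_const_mul]
  refine intervalIntegral.integral_congr fun s hs => ?_
  rw [Set.uIcc_of_le zero_le_one] at hs
  have hm := smul_mem_disc hs z.2
  simp only [extendZero_of_mem _ hm, HvInf.mulCoord_apply]
  ring

lemma HvInf.eq_zero_of_mulCoord_eq_zero {f : HvInf v} (hf : f.mulCoord = 0) : f = 0 := by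
  have hz : ∀ z : Disc, (z : ℂ) ≠ 0 → f z = 0 := fun z hz => by
    have h : (z : ℂ) * f z = 0 := by rw [← HvInf.mulCoord_apply, hf, HvInf.zero_apply]
    exact (mul_eq_zero.1 h).resolve_left hz
  have hball : Metric.ball (0 : ℂ) 1 ∈ 𝓝 0 := Metric.ball_mem_nhds 0 one_pos
  have hc : ContinuousAt (extendZero f) 0 :=
    (DifferentiableOn.continuousOn f.holomorphic).continuousAt hball
  have h0 : extendZero f 0 = 0 := by
    refine tendsto_nhds_unique (hc.tendsto.mono_left (nhdsWithin_le_nhds (s := {0}ᶜ))) ?_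
    refine tendsto_const_nhds.congr' ?_
    filter_upwards [mem_nhdsWithin_of_mem_nhds hball, self_mem_nhdsWithin] with z hz1 hz2
    rw [extendZero_of_mem _ hz1, hz ⟨z, hz1⟩ hz2]
  refine HvInf.ext fun z => ?_
  by_cases h : (z : ℂ) = 0
  · rw [← extendZero_coe f z, h, h0, HvInf.zero_apply]
  · exact hz z h

/-- One step of the downward induction: the operator `μ - T_n` is triangular with respect to the
decomposition `f = f(0) + z g`, with `μ - 1/(n+1)` and `μ - T_{n+1}` on the diagonal. -/
lemma bijective_sub_moment_of_succ {μ : ℂ} {n : ℕ} (hμ : μ ≠ 1 / ((n : ℂ) + 1))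
    (h : Function.Bijective (algebraMap ℂ (HvInf v →L[ℂ] HvInf v) μ - moment v t ht (n + 1))) :
    Function.Bijective (algebraMap ℂ (HvInf v →L[ℂ] HvInf v) μ - moment v t ht n) := by
  have happ : ∀ (k : ℕ) (f : HvInf v), (algebraMap ℂ (HvInf v →L[ℂ] HvInf v) μ - moment v t ht k) f
      = μ • f - moment v t ht k f := fun k f => rfl
  have hmul : ∀ g : HvInf v, μ • g.mulCoord - moment v t ht n g.mulCoord
      = (μ • g - moment v t ht (n + 1) g).mulCoord := fun g => by
    rw [moment_mulCoord]
    refine HvInf.ext fun z => ?_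
    simp only [HvInf.sub_apply, HvInf.smul_apply, HvInf.mulCoord_apply]
    ring
  have hμ' : μ - 1 / ((n : ℂ) + 1) ≠ 0 := sub_ne_zero.2 hμ
  constructor
  · refine (injective_iff_map_eq_zero _).2 fun f hf => ?_
    rw [happ] at hf
    have h0 : (μ - 1 / ((n : ℂ) + 1)) * f origin = 0 := by
      have := congrArg (fun g : HvInf v => g origin) hf
      simp only [HvInf.sub_apply, HvInf.smul_apply, moment_origin, HvInf.zero_apply] at this
      rw [← this]; ring
    obtain ⟨g, rfl⟩ := f.exists_eq_mulCoord ((mul_eq_zero.1 h0).resolve_left hμ')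
    rw [hmul] at hf
    have hg := HvInf.eq_zero_of_mulCoord_eq_zero hf
    rw [← happ] at hg
    rw [(injective_iff_map_eq_zero _).1 h.1 g hg]
    exact HvInf.ext fun z => by rw [HvInf.mulCoord_apply, HvInf.zero_apply, mul_zero]
  · intro g
    -- The constant that solves the equation at the origin; the remainder is then divisible by the
    -- coordinate and is handled by `T_{n+1}`.
    set c := HvInf.const v (g origin / (μ - 1 / ((n : ℂ) + 1))) with hc
    obtain ⟨p, hp⟩ := (g - (μ • c - moment v t ht n c)).exists_eq_mulCoord (by
      simp only [HvInf.sub_apply, HvInf.smul_apply, moment_origin, hc, HvInf.const_apply]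
      rw [← sub_mul, mul_div_cancel₀ _ hμ', sub_self])
    obtain ⟨q, hq⟩ := h.2 p
    refine ⟨c + q.mulCoord, ?_⟩
    rw [happ] at hq
    rw [map_add, happ, happ, hmul, hq, ← hp]
    abel

lemma bijective_sub_moment {μ : ℂ} (h0 : μ ≠ 0) (hμ : ∀ m : ℕ, μ ≠ 1 / ((m : ℂ) + 1)) (n : ℕ) :
    Function.Bijective (algebraMap ℂ (HvInf v →L[ℂ] HvInf v) μ - moment v t ht n) := by
  have h1t : 0 < 1 - t := sub_pos.2 ht.2
  -- Chosen so that `1/((k+1)(1-t)) < ‖μ‖` for all `k ≥ N`, the range of the Neumann series.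
  obtain ⟨N, hN⟩ := exists_nat_gt (1 / ((1 - t) * ‖μ‖))
  have hbig : ∀ k ≥ N,
      Function.Bijective (algebraMap ℂ (HvInf v →L[ℂ] HvInf v) μ - moment v t ht k) := by
    intro k hk
    rw [← ContinuousLinearMap.isUnit_iff_bijective]
    refine spectrum.mem_resolventSet_of_norm_lt_mul ?_
    have hμ0 : 0 < ‖μ‖ := norm_pos_iff.2 h0
    have hle : ‖moment v t ht k‖ * ‖(1 : HvInf v →L[ℂ] HvInf v)‖ ≤ ‖moment v t ht k‖ :=
      mul_le_of_le_one_right (norm_nonneg _) ContinuousLinearMap.norm_id_le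
    refine (hle.trans (norm_moment_le k)).trans_lt ?_
    have hk' : (N : ℝ) ≤ k := by exact_mod_cast hk
    rw [div_lt_iff₀ (by positivity)] at hN ⊢
    refine hN.trans_le ?_
    have : (N : ℝ) ≤ k + 1 := by linarith
    calc (N : ℝ) * ((1 - t) * ‖μ‖) ≤ (k + 1) * ((1 - t) * ‖μ‖) := by gcongr
      _ = ‖μ‖ * ((k + 1) * (1 - t)) := by ring
  -- The descent goes from `k + 1` to `k`, so the induction is on a bound `j` for the distance from
  -- `k` up to `N`.
  have hind : ∀ j k : ℕ, N ≤ k + j →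
      Function.Bijective (algebraMap ℂ (HvInf v →L[ℂ] HvInf v) μ - moment v t ht k) := by
    intro j
    induction j with
    | zero => exact fun k hk => hbig k hk
    | succ j ih => exact fun k hk => bijective_sub_moment_of_succ (hμ k) (ih (k + 1) (by omega))
  exact hind N n (by omega)

/-! ### The Cesàro operator maps `H_v^∞` into `H_v^0` -/

/-- The integral over `s` is split at `1 - δ`. On the first part `sz` stays in a fixed smaller disc,
so that part is bounded and its product with `v` tends to zero. The second part has length `δ` and
contributes at most `δ ‖f‖/(1-t)` after weighting. -/
lemma cesaro_apply_mem_Hv0 (hv : v.VanishesAtOne) (f : HvInf v) : cesaro v t ht f ∈ Hv0 v := by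
  have hv' : Tendsto v.onDisc toBoundary (𝓝 0) := Tendsto.comp hv tendsto_comap
  have h1t : 0 < 1 - t := sub_pos.2 ht.2
  change Tendsto _ _ _
  refine Metric.tendsto_nhds.2 fun ε hε => ?_
  obtain ⟨δ, hδ0, hδ⟩ : ∃ δ ∈ Set.Ioo (0 : ℝ) 1, δ * (‖f‖ / (1 - t)) < ε / 2 := by
    have hl : Tendsto (fun δ : ℝ => δ * (‖f‖ / (1 - t))) (𝓝[>] 0) (𝓝 0) := by
      have : Continuous fun δ : ℝ => δ * (‖f‖ / (1 - t)) := by fun_prop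
      simpa using (this.tendsto 0).mono_left nhdsWithin_le_nhds
    have hI : ∀ᶠ δ in 𝓝[>] (0 : ℝ), δ ∈ Set.Ioo (0 : ℝ) 1 := Ioo_mem_nhdsGT zero_lt_one
    exact (hI.and
      (hl.eventually (gt_mem_nhds (half_pos hε)))).exists
  obtain ⟨M, hM0, hM⟩ := f.holomorphic.bound (ρ := 1 - δ) (by linarith [hδ0.1])
  have hlim : Tendsto (fun z => M / (1 - t) * v.onDisc z) toBoundary (𝓝 0) := by
    simpa using hv'.const_mul (M / (1 - t))
  filter_upwards [hlim.eventually (gt_mem_nhds (half_pos hε))] with z hz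
  have hvz := v.onDisc_pos z
  have hint := intervalIntegrable_integrand ht f.holomorphic z
  have hmem : 1 - δ ∈ Set.uIcc (0 : ℝ) 1 := by
    rw [Set.uIcc_of_le zero_le_one]; constructor <;> linarith [hδ0.1, hδ0.2]
  have hsplit := intervalIntegral.integral_add_adjacent_intervals
    (hint.mono_set (Set.uIcc_subset_uIcc_left hmem))
    (hint.mono_set (Set.uIcc_subset_uIcc_right hmem))
  have hA := intervalIntegral.norm_integral_le_of_norm_le_const (a := 0) (b := 1 - δ)
    (f := fun s : ℝ => extendZero f (s * z) / (1 - t * (s * z))) (C := M / (1 - t)) (by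
      intro s hs
      rw [Set.uIoc_of_le (by linarith [hδ0.2])] at hs
      have hs' : s ∈ Set.Icc (0 : ℝ) 1 := ⟨hs.1.le, by linarith [hs.2, hδ0.1]⟩
      have hm := smul_mem_disc hs' z.2
      rw [extendZero_of_mem _ hm, norm_div]
      refine div_le_div₀ hM0 (hM _ ?_) h1t (one_sub_le_norm ht hm)
      rw [norm_mul, Complex.norm_real, Real.norm_of_nonneg hs'.1]
      exact (mul_le_of_le_one_right hs'.1 (norm_mem_Ico z).2.le).trans hs.2)
  have hB := intervalIntegral.norm_integral_le_of_norm_le_const (a := 1 - δ) (b := 1)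
    (f := fun s : ℝ => extendZero f (s * z) / (1 - t * (s * z)))
    (C := ‖f‖ / v.onDisc z / (1 - t)) (by
      intro s hs
      rw [Set.uIoc_of_le (by linarith [hδ0.1])] at hs
      exact f.norm_integrand_le ht z ⟨by linarith [hs.1, hδ0.2], hs.2⟩)
  rw [sub_zero, abs_of_nonneg (by linarith [hδ0.2])] at hA
  rw [sub_sub_cancel, abs_of_nonneg hδ0.1.le] at hB
  have hA' := hA.trans (mul_le_of_le_one_right (div_nonneg hM0 h1t.le) (by linarith [hδ0.1]))
  rw [cesaro_apply, dist_zero_right, Real.norm_of_nonneg (mul_nonneg (norm_nonneg _) hvz.le),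
    cesaroFun_eq, ← hsplit]
  refine (mul_le_mul_of_nonneg_right ((norm_add_le _ _).trans (add_le_add hA' hB))
    hvz.le).trans_lt ?_
  have : (M / (1 - t) + ‖f‖ / v.onDisc z / (1 - t) * δ) * v.onDisc z
      = M / (1 - t) * v.onDisc z + δ * (‖f‖ / (1 - t)) := by
    field_simp
  rw [this]
  linarith

/-! ### Eigenvalues -/

/-- A primitive `G` of `f(ξ)/(1 - tξ)` satisfies `G(z) - G(0) = z C_t f(z) = 0`, so it is constant
and its derivative vanishes. -/
lemma cesaro_injective {f : HvInf v} (hf : cesaro v t ht f = 0) : f = 0 := by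
  obtain ⟨G, hG⟩ := (f.holomorphic.integrand ht).isExactOn_ball
  have hconst : ∀ z ∈ Metric.ball (0 : ℂ) 1, G z = G 0 := by
    intro z hz
    have key := intervalIntegral.integral_eq_sub_of_hasDerivAt (a := 0) (b := 1)
      (f := fun s : ℝ => G (s * z))
      (f' := fun s : ℝ => extendZero f (s * z) / (1 - t * (s * z)) * z) (by
        intro s hs
        rw [Set.uIcc_of_le zero_le_one] at hs
        have h1 : HasDerivAt (fun s : ℂ => s * z) z (s : ℂ) := by
          simpa using (hasDerivAt_id (s : ℂ)).mul_const z
        exact ((hG _ (smul_mem_disc hs hz)).comp (s : ℂ) h1).comp_ofReal)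
      ((intervalIntegrable_integrand ht f.holomorphic ⟨z, hz⟩).mul_const z)
    have h0 : cesaroFun t f ⟨z, hz⟩ = 0 := by rw [← cesaro_apply v t ht, hf, HvInf.zero_apply]
    rw [cesaroFun_eq] at h0
    rw [intervalIntegral.integral_mul_const, h0, zero_mul] at key
    simp only [Complex.ofReal_one, one_mul, Complex.ofReal_zero, zero_mul] at key
    exact sub_eq_zero.1 key.symm
  refine HvInf.ext fun z => ?_
  have h1 := (hG z z.2).unique ((hasDerivAt_const (z : ℂ) (G 0)).congr_of_eventuallyEq
    (by filter_upwards [Metric.isOpen_ball.mem_nhds z.2] with w hw using hconst w hw))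
  beta_reduce at h1
  rw [extendZero_coe, div_eq_zero_iff] at h1
  exact h1.resolve_right (one_sub_ne_zero ht z.2)

/-- The function `z^m / (1 - tz)^(m+1)`. -/
noncomputable def eigenfunction (v : Weight) (t : ℝ) (ht : t ∈ Set.Ico (0 : ℝ) 1) (m : ℕ) :
    HvInf v :=
  ⟨fun z => (z : ℂ) ^ m / (1 - t * z) ^ (m + 1), mem_HvInfSubmodule_of_bounded
    (isHolomorphic_of_differentiableOn (g := fun z => z ^ m / (1 - t * z) ^ (m + 1))
      (DifferentiableOn.div (by fun_prop) (by fun_prop) fun z hz =>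
        pow_ne_zero _ (one_sub_ne_zero ht hz)))
    (M := 1 / (1 - t) ^ (m + 1)) fun z => by
      rw [norm_div, norm_pow, norm_pow]
      exact div_le_div₀ zero_le_one (pow_le_one₀ (norm_nonneg _) (norm_mem_Ico z).2.le)
        (pow_pos (sub_pos.2 ht.2) _)
        (pow_le_pow_left₀ (sub_pos.2 ht.2).le (one_sub_le_norm ht z.2) _)⟩

lemma eigenfunction_apply (m : ℕ) (z : Disc) :
    eigenfunction v t ht m z = (z : ℂ) ^ m / (1 - t * z) ^ (m + 1) := rfl

lemma eigenfunction_ne_zero (m : ℕ) : eigenfunction v t ht m ≠ 0 := by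
  intro h
  have hz : (1 / 2 : ℂ) ∈ Metric.ball (0 : ℂ) 1 := by
    rw [mem_ball_zero_iff]; norm_num
  have h1 : eigenfunction v t ht m ⟨1 / 2, hz⟩ = 0 := by rw [h, HvInf.zero_apply]
  rw [eigenfunction_apply] at h1
  exact div_ne_zero (pow_ne_zero _ (by norm_num)) (pow_ne_zero _ (one_sub_ne_zero ht hz)) h1

lemma cesaro_eigenfunction (m : ℕ) :
    cesaro v t ht (eigenfunction v t ht m) = (1 / ((m : ℂ) + 1)) • eigenfunction v t ht m := by
  refine HvInf.ext fun z => ?_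
  have hm : (m : ℂ) + 1 ≠ 0 := by exact_mod_cast m.succ_ne_zero
  rw [cesaro_apply, HvInf.smul_apply, eigenfunction_apply, cesaroFun_eq]
  have hi := intervalIntegrable_integrand ht (eigenfunction v t ht m).holomorphic z
  have key := intervalIntegral.integral_eq_sub_of_hasDerivAt (a := 0) (b := 1)
    -- An explicit antiderivative in `s`: it vanishes at `s = 0` and equals the eigenfunction over
    -- `m + 1` at `s = 1`. In its derivative the numerator collapses through `(1 - tsz) + tsz = 1`.
    (f := fun s : ℝ => 1 / ((m : ℂ) + 1) * ((s : ℂ) ^ (m + 1) * z ^ m /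
      (1 - t * (s * z)) ^ (m + 1))) (fun s hs => ?_) hi
  · rw [key]
    simp
  · rw [Set.uIcc_of_le zero_le_one] at hs
    have hmem := smul_mem_disc hs z.2
    have hne := one_sub_ne_zero ht hmem
    have h1 : HasDerivAt (fun s : ℂ => 1 - (t : ℂ) * (s * z)) (-(t * z)) (s : ℂ) := by
      simpa using (((hasDerivAt_id (s : ℂ)).mul_const (z : ℂ)).const_mul (t : ℂ)).const_sub 1
    have h2 := ((((hasDerivAt_pow (m + 1) (s : ℂ)).mul_const ((z : ℂ) ^ m)).div (h1.pow (m + 1))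
      (pow_ne_zero _ hne)).const_mul (1 / ((m : ℂ) + 1))).comp_ofReal
    refine h2.congr_deriv ?_
    rw [extendZero_of_mem _ hmem, eigenfunction_apply]
    simp only [Pi.pow_apply, Nat.add_sub_cancel, Nat.cast_add, Nat.cast_one]
    obtain ⟨w, hw⟩ : ∃ w, w = 1 - (t : ℂ) * (s * z) := ⟨_, rfl⟩
    rw [← hw] at hne ⊢
    field_simp
    linear_combination ((s : ℂ) * z) ^ m * w ^ (m + 1) * hw

/-! ### Spectra -/

lemma mem_pointSpectrum_iff {X : Type*} [NormedAddCommGroup X] [NormedSpace ℂ X] {T : X →L[ℂ] X}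
    {μ : ℂ} : μ ∈ pointSpectrum T ↔ ∃ f, f ≠ 0 ∧ T f = μ • f := by
  constructor
  · intro h
    obtain ⟨f, hf⟩ := Module.End.HasEigenvalue.exists_hasEigenvector h
    exact ⟨f, hf.2, hf.apply_eq_smul⟩
  · rintro ⟨f, hf, h⟩
    exact Module.End.hasEigenvalue_of_hasEigenvector
      ⟨Module.End.mem_eigenspace_iff.2 h, hf⟩

lemma pointSpectrum_subset_spectrum {X : Type*} [NormedAddCommGroup X] [NormedSpace ℂ X]
    (T : X →L[ℂ] X) : pointSpectrum T ⊆ spectrum ℂ T := by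
  intro μ hμ hunit
  obtain ⟨f, hf, h⟩ := mem_pointSpectrum_iff.1 hμ
  obtain ⟨U, hU⟩ := hunit
  refine hf ?_
  have h1 : (U : X →L[ℂ] X) f = 0 := by
    rw [hU]
    change μ • f - T f = 0
    rw [h, sub_self]
  have h2 : ((↑U⁻¹ * ↑U : X →L[ℂ] X)) f = 0 := by
    rw [mul_apply_eq_comp, h1, map_zero]
  simpa using h2

/-- If the eigenvalues are the numbers `1/(m+1)`, and all the other nonzero numbers are regular, then
the spectrum consists of the eigenvalues and `0`. -/
lemma spectrum_eq_of_pointSpectrum_eq {X : Type*} [NormedAddCommGroup X] [NormedSpace ℂ X]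
    [CompleteSpace X] {T : X →L[ℂ] X}
    (hp : pointSpectrum T = Set.range fun m : ℕ => 1 / ((m : ℂ) + 1))
    (hr : ∀ μ : ℂ, μ ≠ 0 → (∀ m : ℕ, μ ≠ 1 / ((m : ℂ) + 1)) →
      Function.Bijective (algebraMap ℂ (X →L[ℂ] X) μ - T)) :
    spectrum ℂ T = (Set.range fun m : ℕ => 1 / ((m : ℂ) + 1)) ∪ {0} := by
  have hsub := pointSpectrum_subset_spectrum T
  rw [hp] at hsub
  refine Set.Subset.antisymm (fun μ hμ => ?_) (Set.union_subset hsub ?_)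
  · by_contra hnot
    simp only [Set.mem_union, Set.mem_range, Set.mem_singleton_iff, not_or, not_exists] at hnot
    exact hμ (ContinuousLinearMap.isUnit_iff_bijective.2
      (hr μ hnot.2 fun m hm => hnot.1 m hm.symm))
  · rw [Set.singleton_subset_iff]
    exact (spectrum.isClosed T).mem_of_tendsto
      (tendsto_one_div_add_atTop_nhds_zero_nat (𝕜 := ℂ))
      (Eventually.of_forall fun m => hsub ⟨m, rfl⟩)

lemma bijective_sub_cesaro {μ : ℂ} (h0 : μ ≠ 0) (hμ : ∀ m : ℕ, μ ≠ 1 / ((m : ℂ) + 1)) :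
    Function.Bijective (algebraMap ℂ (HvInf v →L[ℂ] HvInf v) μ - cesaro v t ht) := by
  rw [← moment_zero]
  exact bijective_sub_moment h0 hμ 0

lemma bijective_sub_cesaro0 (hv : v.VanishesAtOne) {μ : ℂ} (h0 : μ ≠ 0)
    (hμ : ∀ m : ℕ, μ ≠ 1 / ((m : ℂ) + 1)) :
    Function.Bijective (algebraMap ℂ (Hv0 v →L[ℂ] Hv0 v) μ - cesaro0 v hv t ht) := by
  have hb := bijective_sub_cesaro (v := v) (ht := ht) h0 hμ
  have hcoe : ∀ f : Hv0 v, (((algebraMap ℂ (Hv0 v →L[ℂ] Hv0 v) μ - cesaro0 v hv t ht) f : Hv0 v) :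
      HvInf v) = (algebraMap ℂ (HvInf v →L[ℂ] HvInf v) μ - cesaro v t ht) f := fun f => rfl
  constructor
  · intro f g hfg
    exact Subtype.ext (hb.1 (by rw [← hcoe, ← hcoe, hfg]))
  · intro g
    obtain ⟨f, hf⟩ := hb.2 g
    have hf' : μ • f - cesaro v t ht f = g := hf
    have hmem : f ∈ Hv0 v := by
      -- The preimage found in `H_v^∞` satisfies `μ f = g + C_t f`, and both terms on the right lie
      -- in `H_v^0`.
      have h1 : μ • f ∈ Hv0 v := by
        rw [sub_eq_iff_eq_add.1 hf']
        exact (Hv0 v).add_mem g.2 (cesaro_apply_mem_Hv0 hv f)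
      exact ((Hv0 v).smul_mem_iff h0).1 h1
    exact ⟨⟨f, hmem⟩, Subtype.ext ((hcoe ⟨f, hmem⟩).trans hf)⟩

lemma pointSpectrum_cesaro :
    pointSpectrum (cesaro v t ht) = Set.range fun m : ℕ => 1 / ((m : ℂ) + 1) := by
  refine Set.Subset.antisymm (fun μ hμ => ?_) ?_
  · obtain ⟨f, hf, h⟩ := mem_pointSpectrum_iff.1 hμ
    by_contra hnot
    simp only [Set.mem_range, not_exists] at hnot
    refine hf ?_
    by_cases h0 : μ = 0
    · exact cesaro_injective (by rw [h, h0, zero_smul])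
    · refine (injective_iff_map_eq_zero _).1
        (bijective_sub_cesaro (v := v) (ht := ht) h0 fun m hm => hnot m hm.symm).1 f ?_
      change μ • f - cesaro v t ht f = 0
      rw [h, sub_self]
  · rintro _ ⟨m, rfl⟩
    exact mem_pointSpectrum_iff.2
      ⟨eigenfunction v t ht m, eigenfunction_ne_zero m, cesaro_eigenfunction m⟩

/-- The eigenfunctions of the Cesàro operator belong to `H_v^0`. -/
lemma pointSpectrum_cesaro0 (hv : v.VanishesAtOne) :
    pointSpectrum (cesaro0 v hv t ht) = pointSpectrum (cesaro v t ht) := by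
  refine Set.Subset.antisymm (fun μ hμ => ?_) fun μ hμ => ?_
  · obtain ⟨f, hf, h⟩ := mem_pointSpectrum_iff.1 hμ
    exact mem_pointSpectrum_iff.2 ⟨f, fun h0 => hf (Subtype.ext h0), congrArg Subtype.val h⟩
  · obtain ⟨f, hf, h⟩ := mem_pointSpectrum_iff.1 hμ
    have h0 : μ ≠ 0 := by
      rintro rfl
      exact hf (cesaro_injective (h.trans (zero_smul _ _)))
    have hmem : f ∈ Hv0 v := by
      refine ((Hv0 v).smul_mem_iff h0).1 ?_
      rw [← h]
      exact cesaro_apply_mem_Hv0 hv f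
    exact mem_pointSpectrum_iff.2
      ⟨⟨f, hmem⟩, fun h0 => hf (congrArg Subtype.val h0), Subtype.ext h⟩

end WeightedCesaro

theorem mainTheorem1 (v : WeightedCesaro.Weight) (hv : v.VanishesAtOne)
    (t : ℝ) (ht : t ∈ Set.Ico (0 : ℝ) 1) :
    (WeightedCesaro.pointSpectrum (WeightedCesaro.cesaro v t ht) =
        Set.range (fun m : ℕ => 1 / ((m : ℂ) + 1)) ∧
      WeightedCesaro.pointSpectrum (WeightedCesaro.cesaro0 v hv t ht) =
        Set.range (fun m : ℕ => 1 / ((m : ℂ) + 1))) ∧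
    (spectrum ℂ (WeightedCesaro.cesaro v t ht) =
        Set.range (fun m : ℕ => 1 / ((m : ℂ) + 1)) ∪ {0} ∧
      spectrum ℂ (WeightedCesaro.cesaro0 v hv t ht) =
        Set.range (fun m : ℕ => 1 / ((m : ℂ) + 1)) ∪ {0}) := by
  have h := WeightedCesaro.pointSpectrum_cesaro (v := v) (ht := ht)
  have h0 := (WeightedCesaro.pointSpectrum_cesaro0 (ht := ht) hv).trans h
  exact ⟨⟨h, h0⟩,
    WeightedCesaro.spectrum_eq_of_pointSpectrum_eq h fun _ => WeightedCesaro.bijective_sub_cesaro,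
    WeightedCesaro.spectrum_eq_of_pointSpectrum_eq h0 fun _ =>
      WeightedCesaro.bijective_sub_cesaro0 hv⟩
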